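/- All systems are finite-dimensional and nonzero, and $\log$ is to base $2$. Let $S(\rho) = -\mathrm{Tr}(\rho\log\rho)$ be the von Neumann entropy, $h(x) = -x\log x-(1-x)\log(1-x)$ the binary entropy (with $0\log 0=0$), and $\mathcal D(\mathcal H)$ the set of density matrices on $\mathcal H$. For a linear map $\Delta$ put $\|\Delta\|_\diamond = \sup_{k\ge1}\|\Delta\otimes\mathrm{id}_k\|_{1\to1}$ and $\|\Delta\|_{\mathrm{cb}} = \sup_{k\ge1}\|\Delta\otimes\mathrm{id}_k\|_{\infty\to\infty}$, where $\|\cdot\|_{p\to p}$ is induced by the Schatten $p$-norm ($p=1$: trace norm, $p=\infty$: operator norm). Let $\Phi: A\to B$ be a quantum channel (a completely positive trace-preserving linear map) with a Stinespring isometry $V:\mathcal H_A\to\mathcal H_B\otimes\mathcal H_E$, so that $\Phi(\rho)=\mathrm{Tr}_E(V\rho V^\dagger)$, let $\Phi^c(\rho)=\mathrm{Tr}_B(V\rho V^\dagger)$ be the corresponding complementary channel, and let $d_E=\dim\mathcal H_E$. Let $\varepsilon,\nu\ge0$ and let $\Lambda:B\to \tilde E$, with $\mathcal H_{\tilde E}\simeq\mathcal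 H_E$, be a quantum channel such that $$\|\Phi^c-\Lambda\circ\Phi\|_\diamond\le\varepsilon \quad\text{and}\quad \|\Phi^c-\Lambda\circ\Phi\|_{\mathrm{cb}}\le\nu$$ (that is, $\Phi$ is $(\varepsilon,\nu)$-degradable with degrading channel $\Lambda$). Let $W:\mathcal H_B\to\mathcal H_{\tilde E}\otimes\mathcal H_F$ be a Stinespring isometry of $\Lambda$. Define $$Q^{(1)}(\Phi)=\max_{\rho\in\mathcal D(\mathcal H_A)}\bigl(S(\Phi(\rho))-S(\Phi^c(\rho))\bigr),\qquad S(\Phi,\Lambda)=\max_{\rho\in\mathcal D(\mathcal H_A)}\bigl(S(\omega_{\tilde EF})-S(\omega_{\tilde E})\bigr),$$ where $\omega_{E\tilde EF}=(W\otimes\mathbb 1_E)V\rho V^\dagger(W^\dagger\otimes\mathbb 1_E)$ and $\omega_{\tilde EF}$, $\omega_{\tilde E}$ are its reduced states. Both maxima are attained, and if $$\varepsilon\le\frac{2\nu d_E}{\nu d_E+3},$$ then, with $\beta=2\nu/\varepsilon$, $$\bigl|Q^{(1)}(\Phi)-S(\Phi,\Lambda)\bigr|\le\frac{\varepsilon}{2}\log(\beta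 d_E-1)+h(\varepsilon/2),$$ where for $\varepsilon=0$ the right-hand side is read as $0$. -/

import Mathlib

open scoped Kronecker ENNReal ComplexOrder

/-!
Finite-dimensional quantum systems are written in a fixed orthonormal basis: a system with basis
`m` (a finite type) has Hilbert space `ℂ^m` and operator algebra `Matrix m m ℂ`; a composite
system has basis `m × n`.
-/

/-- Density matrices: positive semidefinite operators of unit trace. -/
def IsDensityMatrix {m : Type*} [Fintype m] (ρ : Matrix m m ℂ) : Prop :=
  ρ.PosSemidef ∧ ρ.trace = 1

/-- The trace norm `‖X‖₁ = Tr |X|`, with `|X| = √(X† X)`. -/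
noncomputable def schattenOne {m : Type*} [Fintype m] [DecidableEq m] (X : Matrix m m ℂ) : ℝ :=
  (cfc Real.sqrt (X.conjTranspose * X)).trace.re

/-- The operator norm `‖X‖_∞ = sup {‖X ψ‖ : ‖ψ‖ = 1}` for the Euclidean norm on `ℂ^m`. -/
noncomputable def schattenInf {m : Type*} [Fintype m] [DecidableEq m] (X : Matrix m m ℂ) : ℝ :=
  ‖Matrix.toEuclideanCLM (𝕜 := ℂ) X‖

/-- The von Neumann entropy `S(ρ) = -Tr (ρ log₂ ρ)`, with `0 log 0 = 0`. -/
noncomputable def vonNeumannEntropy {m : Type*} [Fintype m] [DecidableEq m]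
    (ρ : Matrix m m ℂ) : ℝ :=
  -(ρ * cfc (Real.logb 2) ρ).trace.re

/-- The binary entropy in bits, `h(x) = -x log₂ x - (1 - x) log₂ (1 - x)`. -/
noncomputable def binEntropyBits (x : ℝ) : ℝ :=
  -x * Real.logb 2 x - (1 - x) * Real.logb 2 (1 - x)

/-- Partial trace over the second tensor factor, as a linear map. -/
def partialTraceSnd (m n : Type*) [Fintype n] :
    Matrix (m × n) (m × n) ℂ →ₗ[ℂ] Matrix m m ℂ where
  toFun X := Matrix.of fun i i' => ∑ j, X (i, j) (i', j)
  map_add' X Y := by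
    ext i i'
    simp [Finset.sum_add_distrib]
  map_smul' c X := by
    ext i i'
    simp [Finset.mul_sum]

/-- Partial trace over the first tensor factor, as a linear map. -/
def partialTraceFst (m n : Type*) [Fintype m] :
    Matrix (m × n) (m × n) ℂ →ₗ[ℂ] Matrix n n ℂ where
  toFun X := Matrix.of fun j j' => ∑ i, X (i, j) (i, j')
  map_add' X Y := by
    ext j j'
    simp [Finset.sum_add_distrib]
  map_smul' c X := by
    ext j j'
    simp [Finset.mul_sum]

/-- Conjugation `X ↦ V X V†`, as a linear map. -/
def conjMap {m n : Type*} [Fintype m] (V : Matrix n m ℂ) :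
    Matrix m m ℂ →ₗ[ℂ] Matrix n n ℂ where
  toFun X := V * X * V.conjTranspose
  map_add' X Y := by rw [Matrix.mul_add, Matrix.add_mul]
  map_smul' c X := by simp

/-- The ampliation `Φ ⊗ id_k`, with `Φ` acting on each of the `k × k` blocks. -/
def ampliation {m n : Type*} (Φ : Matrix m m ℂ →ₗ[ℂ] Matrix n n ℂ) (k : ℕ)
    (X : Matrix (m × Fin k) (m × Fin k) ℂ) : Matrix (n × Fin k) (n × Fin k) ℂ :=
  Matrix.of fun p q => Φ (Matrix.of fun i i' => X (i, p.2) (i', q.2)) p.1 q.1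

/-- Quantum channels: completely positive trace-preserving linear maps. -/
structure IsQuantumChannel {m n : Type*} [Fintype m] [Fintype n]
    (Φ : Matrix m m ℂ →ₗ[ℂ] Matrix n n ℂ) : Prop where
  completelyPositive : ∀ (k : ℕ) (X : Matrix (m × Fin k) (m × Fin k) ℂ),
    X.PosSemidef → (ampliation Φ k X).PosSemidef
  tracePreserving : ∀ X : Matrix m m ℂ, (Φ X).trace = X.trace

/-- The diamond norm `sup_{k ≥ 1} ‖Φ ⊗ id_k‖_{1 → 1}`, as an extended nonnegative real. -/
noncomputable def diamondNorm {m n : Type*} [Fintype m] [DecidableEq m] [Fintype n] [DecidableEq n]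
    (Φ : Matrix m m ℂ →ₗ[ℂ] Matrix n n ℂ) : ℝ≥0∞ :=
  ⨆ (k : ℕ) (_ : 1 ≤ k) (X : Matrix (m × Fin k) (m × Fin k) ℂ) (_ : schattenOne X ≤ 1),
    ENNReal.ofReal (schattenOne (ampliation Φ k X))

/-- The completely bounded norm `sup_{k ≥ 1} ‖Φ ⊗ id_k‖_{∞ → ∞}`, as an extended nonnegative
real. -/
noncomputable def cbNorm {m n : Type*} [Fintype m] [DecidableEq m] [Fintype n] [DecidableEq n]
    (Φ : Matrix m m ℂ →ₗ[ℂ] Matrix n n ℂ) : ℝ≥0∞ :=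
  ⨆ (k : ℕ) (_ : 1 ≤ k) (X : Matrix (m × Fin k) (m × Fin k) ℂ) (_ : schattenInf X ≤ 1),
    ENNReal.ofReal (schattenInf (ampliation Φ k X))

/-- `V : ℂ^m → ℂ^n ⊗ ℂ^e` is a Stinespring isometry of `Φ`: `V† V = 1` and
`Φ(X) = Tr_e (V X V†)`. -/
structure IsStinespring {m n e : Type*} [Fintype m] [DecidableEq m] [Fintype n] [Fintype e]
    (V : Matrix (n × e) m ℂ) (Φ : Matrix m m ℂ →ₗ[ℂ] Matrix n n ℂ) : Prop where
  isometry : V.conjTranspose * V = 1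
  dilation : ∀ X : Matrix m m ℂ, Φ X = partialTraceSnd n e (conjMap V X)

/-- The complementary channel `Φᶜ(X) = Tr_n (V X V†)` determined by a Stinespring isometry. -/
def complementaryChannel {m n e : Type*} [Fintype m] [Fintype n] (V : Matrix (n × e) m ℂ) :
    Matrix m m ℂ →ₗ[ℂ] Matrix e e ℂ :=
  partialTraceFst n e ∘ₗ conjMap V

/-- `Λ` is a degrading channel exhibiting `(ε, ν)`-degradability of the channel `Φ` with
complementary channel `Φc`. -/
structure IsDegradingChannel {a b e : Type*} [Fintype a] [DecidableEq a] [Fintype b]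
    [Fintype e] [DecidableEq e]
    (Φ : Matrix a a ℂ →ₗ[ℂ] Matrix b b ℂ) (Φc : Matrix a a ℂ →ₗ[ℂ] Matrix e e ℂ)
    (ε ν : ℝ) (Λ : Matrix b b ℂ →ₗ[ℂ] Matrix e e ℂ) : Prop where
  eps_nonneg : 0 ≤ ε
  nu_nonneg : 0 ≤ ν
  channel : IsQuantumChannel Λ
  diamond_le : diamondNorm (Φc - Λ ∘ₗ Φ) ≤ ENNReal.ofReal ε
  cb_le : cbNorm (Φc - Λ ∘ₗ Φ) ≤ ENNReal.ofReal ν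

/-- The values `S(Φ(ρ)) - S(Φᶜ(ρ))` over all states `ρ` of the input system. -/
def coherentInfoValues {a b e : Type*} [Fintype a] [Fintype b] [DecidableEq b]
    [Fintype e] [DecidableEq e]
    (Φ : Matrix a a ℂ →ₗ[ℂ] Matrix b b ℂ) (Φc : Matrix a a ℂ →ₗ[ℂ] Matrix e e ℂ) : Set ℝ :=
  {x | ∃ ρ, IsDensityMatrix ρ ∧ x = vonNeumannEntropy (Φ ρ) - vonNeumannEntropy (Φc ρ)}

/-- The channel coherent information `Q⁽¹⁾(Φ)`. -/
noncomputable def coherentInfo {a b e : Type*} [Fintype a] [Fintype b] [DecidableEq b]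
    [Fintype e] [DecidableEq e]
    (Φ : Matrix a a ℂ →ₗ[ℂ] Matrix b b ℂ) (Φc : Matrix a a ℂ →ₗ[ℂ] Matrix e e ℂ) : ℝ :=
  sSup (coherentInfoValues Φ Φc)

/-- The conditional entropy `S(F|Ẽ)_σ = S(σ) - S(Tr_F σ)` of a state `σ` on `Ẽ ⊗ F`. -/
noncomputable def condEntropySndFst {e f : Type*} [Fintype e] [DecidableEq e]
    [Fintype f] [DecidableEq f] (σ : Matrix (e × f) (e × f) ℂ) : ℝ :=
  vonNeumannEntropy σ - vonNeumannEntropy (partialTraceSnd e f σ)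

/-- The state `ω = (W ⊗ 1) V ρ V† (W† ⊗ 1)` on `(Ẽ ⊗ F) ⊗ E`, for `V : A → B ⊗ E` and
`W : B → Ẽ ⊗ F`. -/
def outputState {a b e f : Type*} [Fintype a] [Fintype b] [Fintype e] [DecidableEq e]
    (V : Matrix (b × e) a ℂ) (W : Matrix (e × f) b ℂ) (ρ : Matrix a a ℂ) :
    Matrix ((e × f) × e) ((e × f) × e) ℂ :=
  conjMap (W ⊗ₖ (1 : Matrix e e ℂ)) (conjMap V ρ)

/-- The values `S(F|Ẽ)_ω` over all states `ρ` of the input system. -/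
def degradingEntropyValues {a b e f : Type*} [Fintype a] [Fintype b]
    [Fintype e] [DecidableEq e] [Fintype f] [DecidableEq f]
    (V : Matrix (b × e) a ℂ) (W : Matrix (e × f) b ℂ) : Set ℝ :=
  {x | ∃ ρ, IsDensityMatrix ρ ∧
    x = condEntropySndFst (partialTraceSnd (e × f) e (outputState V W ρ))}

/-- The quantity `S(Φ, Λ)`, the maximum of `S(F|Ẽ)_ω` over input states, for Stinespring
isometries `V` of `Φ` and `W` of `Λ`. -/
noncomputable def degradingEntropy {a b e f : Type*} [Fintype a] [Fintype b]
    [Fintype e] [DecidableEq e] [Fintype f] [DecidableEq f]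
    (V : Matrix (b × e) a ℂ) (W : Matrix (e × f) b ℂ) : ℝ :=
  sSup (degradingEntropyValues V W)

/-! ### Continuity of the Shannon entropy -/

section EntropyContinuity
open Real Finset

/-! Since `W` is an isometry, `S(ẼF) = S(Φ(ρ))`, so for each state `ρ` the two maximised quantities
differ by exactly `S(Λ(Φ(ρ))) - S(Φᶜ(ρ))`. The two states in this difference are `ε`-close in trace
norm and `ν`-close in operator norm (only `k = 1` in the diamond and cb norms is needed). A bound
uniform in `ρ` on the entropy difference therefore bounds the difference of the maxima, which exist
by compactness.

The entropy bound reduces to a classical one. To bound `S(σ) - S(τ)`, dephase `σ` in the eigenbasis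
of `τ`: this fixes `τ`, does not lower the entropy of `σ` (`sum_negMulLog_eigenvalues_le`), and both
distances dominate their classical counterparts. For the resulting distributions
(`sum_negMulLog_sub_le`) write `p = m + N` and `q = m + P` with `m = min p q`. Then `N` and `P` have
mass `δ` and disjoint supports, and `H(q) - H(p) ≤ H(P) - H(N) + h(δ)`. As `N ≤ ν` entrywise, `H(N)
≥ -δ log ν`. Moreover `N` occupies at least `δ/ν` of the `d` positions, which leaves at most `d -
δ/ν` for `P`, so `H(P) ≤ δ log((d - δ/ν)/δ)`. The sum is `δ log(νd/δ - 1) + h(δ)`.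

This holds for the exact distance `δ`; replacing it by the upper bound `ε/2` needs monotonicity in
`δ` (`entropyBound_mono`), which is what the hypothesis on `ε` provides. -/

theorem negMulLog_add_le {x y : ℝ} (hx : 0 ≤ x) (hy : 0 ≤ y) :
    negMulLog (x + y) ≤ negMulLog x + negMulLog y := by
  rcases hx.eq_or_lt with rfl | hx
  · simp
  rcases hy.eq_or_lt with rfl | hy
  · simp
  have h1 := mul_le_mul_of_nonneg_left (log_le_log hx (by linarith : x ≤ x + y)) hx.le
  have h2 := mul_le_mul_of_nonneg_left (log_le_log hy (by linarith : y ≤ x + y)) hy.le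
  simp only [negMulLog]
  linarith

theorem negMulLog_add_negMulLog_sub {m n : ℝ} (hm : 0 ≤ m) (hn : 0 ≤ n) :
    negMulLog m + negMulLog n - negMulLog (m + n) = (m + n) * binEntropy (n / (m + n)) := by
  rcases hm.eq_or_lt with rfl | hm
  · rcases hn.eq_or_lt with rfl | hn
    · simp
    · simp [hn.ne']
  rcases hn.eq_or_lt with rfl | hn
  · simp
  have h : m + n ≠ 0 := by positivity
  have h1 : 1 - n / (m + n) = m / (m + n) := by field_simp; ring
  rw [binEntropy_eq_negMulLog_add_negMulLog_one_sub, h1]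
  simp only [negMulLog]
  rw [log_div hm.ne' h, log_div hn.ne' h]
  field_simp
  ring

/-- Conditioning reduces entropy: the left side is the entropy of a bit, choosing between `m` and
`n`, conditioned on the index `i`. It is Jensen's inequality for `binEntropy` with weights `m i + n
i`. -/
theorem sum_negMulLog_sub_le_binEntropy {ι : Type*} [Fintype ι] {m n : ι → ℝ}
    (hm : ∀ i, 0 ≤ m i) (hn : ∀ i, 0 ≤ n i) (h1 : ∑ i, (m i + n i) = 1) :
    ∑ i, (negMulLog (m i) + negMulLog (n i) - negMulLog (m i + n i)) ≤
      binEntropy (∑ i, n i) := by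
  have hJ := strictConcave_binEntropy.concaveOn.le_map_sum (t := univ)
    (w := fun i => m i + n i) (p := fun i => n i / (m i + n i))
    (fun i _ => add_nonneg (hm i) (hn i)) h1
    (fun i _ => ⟨div_nonneg (hn i) (add_nonneg (hm i) (hn i)),
      div_le_one_of_le₀ (by linarith [hm i]) (add_nonneg (hm i) (hn i))⟩)
  simp only [smul_eq_mul] at hJ
  have h2 : ∀ i, (m i + n i) * (n i / (m i + n i)) = n i := fun i =>
    mul_div_cancel_of_imp' fun h => by linarith [hm i, hn i]
  simp only [h2] at hJ
  simpa only [negMulLog_add_negMulLog_sub (hm _) (hn _)] using hJ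

/-- The entropy of a nonnegative vector in terms of a bound on the size of its support. -/
theorem sum_negMulLog_le_of_card_support {ι : Type*} [Fintype ι] {P : ι → ℝ} (hP : ∀ i, 0 ≤ P i)
    {δ k : ℝ} (hδ : ∑ i, P i = δ) (hδ0 : 0 < δ)
    (hk : ((univ.filter fun i => 0 < P i).card : ℝ) ≤ k) (hk0 : 0 < k) :
    ∑ i, negMulLog (P i) ≤ δ * log (k / δ) := by
  set s := univ.filter fun i => 0 < P i
  have hs0 : ∀ i ∉ s, P i = 0 := fun i hi =>
    le_antisymm (not_lt.mp fun h => hi (by simp [s, h])) (hP i)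
  have e1 : ∑ i, negMulLog (P i) = ∑ i ∈ s, negMulLog (P i) :=
    (sum_subset (subset_univ s) fun i _ hi => by simp [hs0 i hi]).symm
  have e2 : ∑ i ∈ s, P i = δ := by
    rw [← hδ]
    exact sum_subset (subset_univ s) fun i _ hi => hs0 i hi
  -- Gibbs' inequality against the constant vector `δ / k`, from `log x ≤ x - 1`. The real `k` need
  -- not be an integer; the error terms sum to at most `0` because `s.card ≤ k`.
  have h : ∀ i ∈ s, negMulLog (P i) ≤ P i * log (k / δ) + (δ / k - P i) := by
    intro i hi
    have hi : 0 < P i := by simpa [s] using hi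
    have hl := log_le_sub_one_of_pos (x := δ / k / P i) (by positivity)
    rw [log_div (by positivity) hi.ne', log_div hδ0.ne' hk0.ne'] at hl
    have := mul_le_mul_of_nonneg_left hl hi.le
    rw [log_div hk0.ne' hδ0.ne', negMulLog]
    have e : P i * (δ / k / P i - 1) = δ / k - P i := by field_simp
    linarith
  have hc : s.card * (δ / k) ≤ δ := by
    calc s.card * (δ / k) ≤ k * (δ / k) := by gcongr
      _ = δ := by field_simp
  calc ∑ i, negMulLog (P i) ≤ ∑ i ∈ s, (P i * log (k / δ) + (δ / k - P i)) := by
        rw [e1]; exact sum_le_sum h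
    _ = δ * log (k / δ) + (s.card * (δ / k) - δ) := by
        rw [sum_add_distrib, sum_sub_distrib, ← sum_mul, e2, sum_const, nsmul_eq_mul]
    _ ≤ _ := by linarith

/-- Continuity of the Shannon entropy, with the exact total variation distance `δ` and a bound `ν`
on the entrywise distance. -/
theorem sum_negMulLog_sub_le {ι : Type*} [Fintype ι] {p q : ι → ℝ}
    (hp : ∀ i, 0 ≤ p i) (hq : ∀ i, 0 ≤ q i) (hp1 : ∑ i, p i = 1) (hq1 : ∑ i, q i = 1)
    {δ ν : ℝ} (hδ : ∑ i, |p i - q i| = 2 * δ) (hδ0 : 0 < δ) (hν : ∀ i, |p i - q i| ≤ ν) :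
    ∑ i, negMulLog (q i) - ∑ i, negMulLog (p i) ≤
      δ * log (ν * Fintype.card ι / δ - 1) + binEntropy δ := by
  set m : ι → ℝ := fun i => min (p i) (q i)
  set P : ι → ℝ := fun i => q i - m i
  set N : ι → ℝ := fun i => p i - m i
  have hm : ∀ i, 0 ≤ m i := fun i => le_min (hp i) (hq i)
  have hP : ∀ i, 0 ≤ P i := fun i => sub_nonneg.mpr (min_le_right _ _)
  have hN : ∀ i, 0 ≤ N i := fun i => sub_nonneg.mpr (min_le_left _ _)
  have hPN : ∀ i, P i + N i = |p i - q i| := by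
    intro i
    simp only [P, N, m]
    rcases le_total (p i) (q i) with h | h
    · rw [min_eq_left h, abs_of_nonpos (by linarith)]; ring
    · rw [min_eq_right h, abs_of_nonneg (by linarith)]; ring
  have hPN0 : ∀ i, 0 < P i → N i = 0 := by
    intro i h
    simp only [P, N, m] at h ⊢
    rcases le_total (p i) (q i) with h' | h'
    · rw [min_eq_left h']; ring
    · rw [min_eq_right h'] at h; linarith
  have hs : ∑ i, P i + ∑ i, N i = 2 * δ := by
    rw [← sum_add_distrib, ← hδ]; exact sum_congr rfl fun i _ => hPN i
  have hd : ∑ i, P i = ∑ i, N i := by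
    simp only [P, N, sum_sub_distrib, hp1, hq1]
  have hPδ : ∑ i, P i = δ := by linarith
  have hNδ : ∑ i, N i = δ := by linarith
  have hNν : ∀ i, N i ≤ ν := fun i => by linarith [hν i, hPN i, hP i]
  have hν0 : 0 < ν := by
    by_contra h
    have : ∑ i, N i ≤ 0 := sum_nonpos fun i _ => by linarith [hNν i]
    linarith
  -- `N` vanishes on the support of `P`, has mass `δ` and entries at most `ν`, so it needs at least
  -- `δ / ν` indices outside that support.
  have hcard : ((univ.filter fun i => 0 < P i).card : ℝ) ≤ Fintype.card ι - δ / ν := by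
    have h1 : δ ≤ (univ.filter fun i => ¬ 0 < P i).card * ν := by
      rw [← hNδ, ← sum_filter_add_sum_filter_not univ (fun i => 0 < P i), sum_eq_zero
        (s := univ.filter fun i => 0 < P i) fun i hi => hPN0 i (by simpa using hi), zero_add,
        ← nsmul_eq_mul]
      exact sum_le_card_nsmul _ _ _ fun i _ => hNν i
    have h2 : ((univ.filter fun i => 0 < P i).card : ℝ) +
        (univ.filter fun i => ¬ 0 < P i).card = Fintype.card ι := by
      exact_mod_cast card_filter_add_card_filter_not (s := (univ : Finset ι)) fun i => 0 < P i
    have h3 : δ / ν ≤ (univ.filter fun i => ¬ 0 < P i).card := (div_le_iff₀ hν0).mpr h1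
    linarith
  have hk0 : 0 < Fintype.card ι - δ / ν := by
    refine lt_of_lt_of_le ?_ hcard
    have : (univ.filter fun i => 0 < P i).Nonempty := by
      by_contra h
      rw [not_nonempty_iff_eq_empty, filter_eq_empty_iff] at h
      have : ∑ i, P i ≤ 0 := sum_nonpos fun i hi => not_lt.mp (h hi)
      linarith
    exact_mod_cast this.card_pos
  have hA := sum_negMulLog_le_of_card_support hP hPδ hδ0 hcard hk0
  have hB : -(δ * log ν) ≤ ∑ i, negMulLog (N i) := by
    rw [← hNδ, sum_mul, ← sum_neg_distrib]
    refine sum_le_sum fun i _ => ?_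
    rcases (hN i).eq_or_lt with h | h
    · simp [← h]
    · have := mul_le_mul_of_nonneg_left (log_le_log h (hNν i)) h.le
      rw [negMulLog]; linarith
  have hC : ∑ i, negMulLog (q i) ≤ ∑ i, negMulLog (m i) + ∑ i, negMulLog (P i) := by
    rw [← sum_add_distrib]
    refine sum_le_sum fun i _ => ?_
    have := negMulLog_add_le (hm i) (hP i)
    rwa [show m i + P i = q i by simp [P]] at this
  have hmN : ∀ i, m i + N i = p i := fun i => by simp [N]
  have hD := sum_negMulLog_sub_le_binEntropy hm hN (by simpa only [hmN] using hp1)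
  simp only [hmN, hNδ, sum_sub_distrib, sum_add_distrib] at hD
  -- The terms `H(P) ≤ δ log((d - δ/ν)/δ)` and `-H(N) ≤ δ log ν` merge into one logarithm.
  have hE : δ * log (ν * Fintype.card ι / δ - 1) =
      δ * log ((Fintype.card ι - δ / ν) / δ) + δ * log ν := by
    rw [← mul_add, ← log_mul (by positivity) hν0.ne']
    congr 2
    field_simp
  linarith

/-- The difference of the two sides is increasing on `(0, 1]`, with derivative `(4 - x) / (x (2 +
x)²)`, and equals `1 - log 3 ≤ 0` at `x = 1`. The inequality `e ≤ 3` is thus what makes the constant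
`3` in the hypothesis on `ε` sufficient. -/
theorem three_mul_div_le_log {x : ℝ} (h0 : 0 < x) (h1 : x < 1) :
    3 / (2 + x) ≤ log (1 + 2 / x) := by
  have hmono : MonotoneOn (fun x : ℝ => 3 / (2 + x) - log (1 + 2 / x)) (Set.Ioc 0 1) := by
    refine monotoneOn_of_deriv_nonneg (convex_Ioc 0 1) ?_ ?_ ?_
    · refine ContinuousOn.sub (ContinuousOn.div (by fun_prop) (by fun_prop) ?_)
        (ContinuousOn.log (ContinuousOn.add (by fun_prop)
          (ContinuousOn.div (by fun_prop) (by fun_prop) ?_)) ?_)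
      all_goals intro y hy; have := hy.1; positivity
    · rw [interior_Ioc]
      intro y hy
      have := hy.1
      refine DifferentiableAt.differentiableWithinAt ?_
      exact DifferentiableAt.sub (DifferentiableAt.div (by fun_prop) (by fun_prop) (by positivity))
        (DifferentiableAt.log (DifferentiableAt.add (by fun_prop)
          (DifferentiableAt.div (by fun_prop) (by fun_prop) (by positivity))) (by positivity))
    · rw [interior_Ioc]
      intro y hy
      have hy0 := hy.1
      have hy1 := hy.2
      have d1 : HasDerivAt (fun x : ℝ => 3 / (2 + x)) ((0 * (2 + y) - 3 * 1) / (2 + y) ^ 2) y :=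
        (hasDerivAt_const y (3 : ℝ)).fun_div ((hasDerivAt_id' y).const_add 2) (by positivity)
      have d2 : HasDerivAt (fun x : ℝ => 2 / x) ((0 * y - 2 * 1) / y ^ 2) y :=
        (hasDerivAt_const y (2 : ℝ)).fun_div (hasDerivAt_id' y) (by positivity)
      have d3 := d1.fun_sub ((d2.const_add 1).log (by positivity))
      rw [d3.deriv]
      have : (0 * (2 + y) - 3 * 1) / (2 + y) ^ 2 - (0 * y - 2 * 1) / y ^ 2 / (1 + 2 / y) =
          (4 - y) / (y * (2 + y) ^ 2) := by
        field_simp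
        ring
      rw [this]
      exact div_nonneg (by linarith) (by positivity)
  have h := hmono ⟨h0, h1.le⟩ ⟨one_pos, le_rfl⟩ h1.le
  have h3 : 1 ≤ log 3 := by
    rw [le_log_iff_exp_le (by norm_num)]
    exact (exp_one_lt_d9.trans (by norm_num)).le
  norm_num at h
  linarith

/-- Monotonicity of the entropy bound in the trace distance. -/
theorem entropyBound_mono {N δ₀ δ : ℝ} (h0 : 0 < δ₀) (h : δ₀ ≤ δ) (hδ : δ * (N + 3) ≤ N)
    (hN : 0 < N) :
    δ₀ * log (N / δ₀ - 1) + binEntropy δ₀ ≤ δ * log (N / δ - 1) + binEntropy δ := by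
  have key : ∀ x ∈ Set.Ioc 0 δ, x < 1 ∧ 3 * x ≤ N * (1 - x) := by
    intro x hx
    have h1 : x * (N + 3) ≤ N := (mul_le_mul_of_nonneg_right hx.2 (by linarith)).trans hδ
    refine ⟨?_, by linarith⟩
    by_contra h2
    nlinarith
  have der : ∀ x ∈ Set.Ioc 0 δ, HasDerivAt (fun x => x * log (N / x - 1) + binEntropy x)
      (1 * log (N / x - 1) + x * ((0 * x - N * 1) / x ^ 2 / (N / x - 1)) +
        (log (1 - x) - log x)) x ∧ 0 ≤ 1 * log (N / x - 1) +
          x * ((0 * x - N * 1) / x ^ 2 / (N / x - 1)) + (log (1 - x) - log x) := by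
    intro x hx
    obtain ⟨hx1, hx3⟩ := key x hx
    have hx0 := hx.1
    have h1x : 0 < 1 - x := by linarith
    -- Equivalent to `3 * x ≤ N * (1 - x)`, the threshold condition at `x`.
    have hNx : (2 + x) / (1 - x) ≤ N / x - 1 := by
      rw [div_le_iff₀ h1x, sub_mul, div_mul_eq_mul_div, le_sub_iff_add_le, le_div_iff₀ hx0]
      linarith
    have hp : 0 < (2 + x) / (1 - x) := by positivity
    have hpos : 0 < N / x - 1 := by linarith
    refine ⟨?_, ?_⟩
    · have d2 : HasDerivAt (fun x : ℝ => N / x) ((0 * x - N * 1) / x ^ 2) x :=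
        (hasDerivAt_const x N).fun_div (hasDerivAt_id' x) (by positivity)
      exact ((hasDerivAt_id' x).fun_mul ((d2.sub_const 1).log hpos.ne')).fun_add
        (hasDerivAt_binEntropy hx0.ne' hx1.ne)
    -- The derivative is `log u - 1 - 1/u + log(1 - x) - log x`, increasing in `u`. At the least
    -- admissible `u = (2 + x)/(1 - x)` it equals `log(1 + 2/x) - 3/(2 + x)`.
    · set u := N / x - 1
      have e1 : x * ((0 * x - N * 1) / x ^ 2 / u) = -(1 + 1 / u) := by
        have : N = x * (u + 1) := by simp only [u]; field_simp; ring
        rw [this]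
        field_simp
        ring
      have e2 : 1 / u ≤ (1 - x) / (2 + x) := by
        rw [← one_div_div (2 + x)]
        exact one_div_le_one_div_of_le hp hNx
      have e3 : 1 + (1 - x) / (2 + x) = 3 / (2 + x) := by field_simp; ring
      have e4 : log ((2 + x) / (1 - x)) ≤ log u := log_le_log hp hNx
      have e5 : log ((2 + x) / (1 - x)) + log (1 - x) - log x = log (1 + 2 / x) := by
        rw [log_div (by positivity) h1x.ne', show 1 + 2 / x = (2 + x) / x by field_simp; ring,
          log_div (by positivity) hx0.ne']
        ring
      have e6 := three_mul_div_le_log hx0 hx1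
      rw [e1]
      linarith
  refine monotoneOn_of_deriv_nonneg (D := Set.Ioc 0 δ)
    (f := fun x => x * log (N / x - 1) + binEntropy x) (convex_Ioc 0 δ)
    (fun x hx => (der x hx).1.continuousAt.continuousWithinAt)
    (fun x hx => ((der x (interior_subset hx)).1.differentiableAt).differentiableWithinAt)
    (fun x hx => ?_) ⟨h0, h⟩ ⟨h0.trans_le h, le_rfl⟩ h
  rw [(der x (interior_subset hx)).1.deriv]
  exact (der x (interior_subset hx)).2

/-- Continuity of the Shannon entropy in terms of the total variation distance and the entrywise
distance. -/
theorem sum_negMulLog_sub_le_of_le {ι : Type*} [Fintype ι] {p q : ι → ℝ}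
    (hp : ∀ i, 0 ≤ p i) (hq : ∀ i, 0 ≤ q i) (hp1 : ∑ i, p i = 1) (hq1 : ∑ i, q i = 1)
    {δ ν : ℝ} (hν0 : 0 ≤ ν) (hδ0 : 0 ≤ δ) (hδ : ∑ i, |p i - q i| ≤ 2 * δ)
    (hν : ∀ i, |p i - q i| ≤ ν)
    (hδν : δ ≤ ν * Fintype.card ι / (ν * Fintype.card ι + 3)) :
    ∑ i, negMulLog (q i) - ∑ i, negMulLog (p i) ≤
      δ * log (ν * Fintype.card ι / δ - 1) + binEntropy δ := by
  set N : ℝ := ν * Fintype.card ι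
  have hN0 : 0 ≤ N := by positivity
  rw [le_div_iff₀ (by positivity)] at hδν
  rcases (show 0 ≤ ∑ i, |p i - q i| from sum_nonneg fun i _ => abs_nonneg _).eq_or_lt with h | h
  -- Equal distributions: only nonnegativity of the bound remains. For `δ = 0` it is `0`, since the
  -- factor `δ` kills the logarithm.
  · have hpq : ∀ i, p i = q i := fun i => sub_eq_zero.mp <| abs_eq_zero.mp <|
      (sum_eq_zero_iff_of_nonneg fun i _ => abs_nonneg _).mp h.symm i (mem_univ i)
    simp only [hpq, sub_self]
    rcases hδ0.eq_or_lt with rfl | hδ0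
    · simp
    have h1 : δ ≤ 1 := by nlinarith
    refine add_nonneg (mul_nonneg hδ0.le (log_nonneg ?_)) (binEntropy_nonneg hδ0.le h1)
    have : 2 ≤ N / δ := by rw [le_div_iff₀ hδ0]; nlinarith
    linarith
  · have h2 : ∑ i, |p i - q i| = 2 * ((∑ i, |p i - q i|) / 2) := by ring
    have hδ' : 0 < δ := by linarith
    have hN : 0 < N := by nlinarith
    exact (sum_negMulLog_sub_le hp hq hp1 hq1 h2 (by positivity) hν).trans
      (entropyBound_mono (by positivity) (by linarith) hδν hN)

/-! ### Von Neumann entropy: reduction to diagonals -/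

section Entropy
variable {n : Type*} [Fintype n] [DecidableEq n]

theorem trace_cfc_re {X : Matrix n n ℂ} (hX : X.IsHermitian) (f : ℝ → ℝ) :
    (cfc f X).trace.re = ∑ i, f (hX.eigenvalues i) := by
  rw [hX.cfc_eq, Matrix.IsHermitian.cfc, Unitary.conjStarAlgAut_apply, Matrix.trace_mul_cycle,
    Unitary.coe_star_mul_self, one_mul, Matrix.trace_diagonal]
  simp

theorem vonNeumannEntropy_eq_trace_cfc {ρ : Matrix n n ℂ} (hρ : ρ.IsHermitian) :
    vonNeumannEntropy ρ = (cfc negMulLog ρ).trace.re / log 2 := by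
  have h : ρ * cfc (Real.logb 2) ρ = cfc (fun x => x * Real.logb 2 x) ρ := by
    rw [cfc_mul (fun x => x) (Real.logb 2) ρ (by fun_prop)
      (Matrix.finite_real_spectrum.continuousOn _), cfc_id' ℝ ρ hρ.isSelfAdjoint]
  rw [vonNeumannEntropy, h, trace_cfc_re hρ, trace_cfc_re hρ, Finset.sum_div,
    ← Finset.sum_neg_distrib]
  refine Finset.sum_congr rfl fun i _ => ?_
  rw [negMulLog, Real.logb]
  ring

theorem vonNeumannEntropy_eq_sum {ρ : Matrix n n ℂ} (hρ : ρ.IsHermitian) :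
    vonNeumannEntropy ρ = (∑ i, negMulLog (hρ.eigenvalues i)) / log 2 := by
  rw [vonNeumannEntropy_eq_trace_cfc hρ, trace_cfc_re hρ]

theorem sum_normSq_row (U : Matrix.unitaryGroup n ℂ) (i : n) :
    ∑ j, Complex.normSq ((U : Matrix n n ℂ) i j) = 1 := by
  have h := congrFun (congrFun (Matrix.mem_unitaryGroup_iff.mp U.2) i) i
  rw [Matrix.mul_apply, Matrix.one_apply_eq] at h
  have := congrArg Complex.re h
  simpa [Matrix.star_apply, Complex.mul_conj, Complex.normSq_apply] using this

theorem sum_normSq_col (U : Matrix.unitaryGroup n ℂ) (j : n) :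
    ∑ i, Complex.normSq ((U : Matrix n n ℂ) i j) = 1 := by
  have := sum_normSq_row (star U) j
  simpa [Matrix.star_apply] using this

/-- The diagonal entries of a Hermitian matrix in an orthonormal basis. -/
noncomputable def diagIn (U : Matrix.unitaryGroup n ℂ) (X : Matrix n n ℂ) (i : n) : ℝ :=
  ((star U : Matrix n n ℂ) * X * (U : Matrix n n ℂ)) i i |>.re

/-- The weights are the squared moduli of the entries of a unitary, hence doubly stochastic. Every
comparison between diagonal and spectrum below rests on this averaging. -/
theorem diagIn_eq_sum (U : Matrix.unitaryGroup n ℂ) {X : Matrix n n ℂ} (hX : X.IsHermitian)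
    (i : n) : diagIn U X i =
      ∑ j, Complex.normSq (((star U * hX.eigenvectorUnitary : Matrix.unitaryGroup n ℂ) :
        Matrix n n ℂ) i j) * hX.eigenvalues j := by
  set M : Matrix.unitaryGroup n ℂ := star U * hX.eigenvectorUnitary
  have h : (star U : Matrix n n ℂ) * X * (U : Matrix n n ℂ) =
      (M : Matrix n n ℂ) * Matrix.diagonal (RCLike.ofReal ∘ hX.eigenvalues) *
        (star M : Matrix n n ℂ) := by
    conv_lhs => rw [hX.spectral_theorem, Unitary.conjStarAlgAut_apply]
    simp only [M, Submonoid.coe_mul, Unitary.coe_star, star_mul, star_star, mul_assoc]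
  rw [diagIn, h, Matrix.mul_apply, Complex.re_sum]
  refine Finset.sum_congr rfl fun j _ => ?_
  rw [Matrix.mul_diagonal, Matrix.star_apply]
  simp [Complex.normSq_apply]
  ring

theorem diagIn_sub (U : Matrix.unitaryGroup n ℂ) (X Y : Matrix n n ℂ) (i : n) :
    diagIn U (X - Y) i = diagIn U X i - diagIn U Y i := by
  simp [diagIn, mul_sub, sub_mul]

theorem diagIn_eigenvectorUnitary {X : Matrix n n ℂ} (hX : X.IsHermitian) (i : n) :
    diagIn hX.eigenvectorUnitary X i = hX.eigenvalues i := by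
  rw [diagIn_eq_sum _ hX, Finset.sum_eq_single i]
  · simp
  · intro j _ hj
    simp [Matrix.one_apply_ne hj.symm]
  · simp

theorem sum_diagIn (U : Matrix.unitaryGroup n ℂ) (X : Matrix n n ℂ) :
    ∑ i, diagIn U X i = X.trace.re := by
  have : X.trace = ((star U : Matrix n n ℂ) * X * (U : Matrix n n ℂ)).trace := by
    rw [Matrix.trace_mul_cycle, ← Unitary.coe_star, Unitary.coe_mul_star_self, one_mul]
  rw [this, Matrix.trace, Complex.re_sum]
  rfl

theorem diagIn_nonneg (U : Matrix.unitaryGroup n ℂ) {X : Matrix n n ℂ} (hX : X.PosSemidef)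
    (i : n) : 0 ≤ diagIn U X i := by
  rw [diagIn_eq_sum _ hX.1]
  exact Finset.sum_nonneg fun j _ => mul_nonneg (Complex.normSq_nonneg _) (hX.eigenvalues_nonneg j)

/-- Dephasing in an orthonormal basis does not decrease the entropy. -/
theorem sum_negMulLog_eigenvalues_le (U : Matrix.unitaryGroup n ℂ) {X : Matrix n n ℂ}
    (hX : X.PosSemidef) :
    ∑ j, negMulLog (hX.1.eigenvalues j) ≤ ∑ i, negMulLog (diagIn U X i) := by
  set M : Matrix.unitaryGroup n ℂ := star U * hX.1.eigenvectorUnitary with hM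
  -- Jensen's inequality along the rows; summing over `i` then uses that the columns sum to one.
  have h : ∀ i, ∑ j, Complex.normSq ((M : Matrix n n ℂ) i j) * negMulLog (hX.1.eigenvalues j) ≤
      negMulLog (diagIn U X i) := by
    intro i
    have := concaveOn_negMulLog.le_map_sum (t := univ)
      (w := fun j => Complex.normSq ((M : Matrix n n ℂ) i j)) (p := hX.1.eigenvalues)
      (fun _ _ => Complex.normSq_nonneg _) (sum_normSq_row M i)
      (fun j _ => hX.eigenvalues_nonneg j)
    rw [diagIn_eq_sum _ hX.1]
    simpa only [smul_eq_mul] using this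
  calc ∑ j, negMulLog (hX.1.eigenvalues j)
      = ∑ j, (∑ i, Complex.normSq ((M : Matrix n n ℂ) i j)) * negMulLog (hX.1.eigenvalues j) := by
        simp only [sum_normSq_col, one_mul]
    _ = ∑ i, ∑ j, Complex.normSq ((M : Matrix n n ℂ) i j) * negMulLog (hX.1.eigenvalues j) := by
        simp only [Finset.sum_mul]; exact Finset.sum_comm
    _ ≤ _ := Finset.sum_le_sum fun i _ => h i

theorem schattenOne_eq_sum {X : Matrix n n ℂ} (hX : X.IsHermitian) :
    schattenOne X = ∑ i, |hX.eigenvalues i| := by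
  have h : X.conjTranspose * X = cfc (fun x : ℝ => x * x) X := by
    rw [hX.eq, cfc_mul (fun x => x) (fun x => x) X, cfc_id' ℝ X hX.isSelfAdjoint]
  rw [schattenOne, h, ← cfc_comp' Real.sqrt (fun x : ℝ => x * x) X, trace_cfc_re hX]
  simp only [Real.sqrt_mul_self_eq_abs]

theorem sum_abs_diagIn_le (U : Matrix.unitaryGroup n ℂ) {X : Matrix n n ℂ}
    (hX : X.IsHermitian) : ∑ i, |diagIn U X i| ≤ schattenOne X := by
  set M : Matrix.unitaryGroup n ℂ := star U * hX.eigenvectorUnitary with hM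
  rw [schattenOne_eq_sum hX]
  calc ∑ i, |diagIn U X i|
      ≤ ∑ i, ∑ j, Complex.normSq ((M : Matrix n n ℂ) i j) * |hX.eigenvalues j| := by
        refine Finset.sum_le_sum fun i _ => ?_
        rw [diagIn_eq_sum _ hX]
        refine (Finset.abs_sum_le_sum_abs _ _).trans_eq (Finset.sum_congr rfl fun j _ => ?_)
        rw [abs_mul, abs_of_nonneg (Complex.normSq_nonneg _)]
    _ = ∑ j, (∑ i, Complex.normSq ((M : Matrix n n ℂ) i j)) * |hX.eigenvalues j| := by
        simp only [Finset.sum_mul]; exact Finset.sum_comm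
    _ = _ := by simp only [sum_normSq_col, one_mul]

theorem abs_eigenvalues_le_schattenInf {X : Matrix n n ℂ} (hX : X.IsHermitian) (j : n) :
    |hX.eigenvalues j| ≤ schattenInf X := by
  have h := (Matrix.toEuclideanCLM (𝕜 := ℂ) X).le_opNorm (hX.eigenvectorBasis j)
  have e : Matrix.toEuclideanCLM (𝕜 := ℂ) X (hX.eigenvectorBasis j) =
      (hX.eigenvalues j : ℂ) • hX.eigenvectorBasis j := by
    apply WithLp.ofLp_injective
    rw [Matrix.ofLp_toEuclideanCLM, hX.mulVec_eigenvectorBasis]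
    rfl
  rw [e, norm_smul, hX.eigenvectorBasis.norm_eq_one, mul_one, mul_one] at h
  rw [schattenInf]
  simpa using h

theorem abs_diagIn_le (U : Matrix.unitaryGroup n ℂ) {X : Matrix n n ℂ}
    (hX : X.IsHermitian) (i : n) : |diagIn U X i| ≤ schattenInf X := by
  set M : Matrix.unitaryGroup n ℂ := star U * hX.eigenvectorUnitary with hM
  rw [diagIn_eq_sum _ hX]
  calc _ ≤ ∑ j, Complex.normSq ((M : Matrix n n ℂ) i j) * schattenInf X := by
        refine (Finset.abs_sum_le_sum_abs _ _).trans (Finset.sum_le_sum fun j _ => ?_)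
        rw [abs_mul, abs_of_nonneg (Complex.normSq_nonneg _)]
        exact mul_le_mul_of_nonneg_left (abs_eigenvalues_le_schattenInf hX j)
          (Complex.normSq_nonneg _)
    _ = _ := by rw [← Finset.sum_mul, sum_normSq_row, one_mul]

theorem binEntropyBits_eq (x : ℝ) : binEntropyBits x = binEntropy x / log 2 := by
  simp only [binEntropyBits, Real.logb, binEntropy, Real.log_inv]
  ring

/-- Continuity of the von Neumann entropy in terms of the trace distance and the operator norm
distance. -/
theorem vonNeumannEntropy_sub_le {σ τ : Matrix n n ℂ} (hσ : IsDensityMatrix σ)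
    (hτ : IsDensityMatrix τ) {ε ν : ℝ} (hε : 0 ≤ ε) (hν : 0 ≤ ν)
    (h1 : schattenOne (τ - σ) ≤ ε) (hinf : schattenInf (τ - σ) ≤ ν)
    (hεν : ε ≤ 2 * ν * (Fintype.card n : ℝ) / (ν * (Fintype.card n : ℝ) + 3)) :
    vonNeumannEntropy σ - vonNeumannEntropy τ ≤
      ε / 2 * Real.logb 2 (2 * ν / ε * (Fintype.card n : ℝ) - 1) + binEntropyBits (ε / 2) := by
  have hH : (τ - σ).IsHermitian := hτ.1.1.sub hσ.1.1
  -- In the eigenbasis of `τ` the diagonal of `τ` is its spectrum, so nothing is lost on that side.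
  have key := sum_negMulLog_sub_le_of_le (p := hτ.1.1.eigenvalues) (q := diagIn hτ.1.1.eigenvectorUnitary σ)
    (δ := ε / 2) (ν := ν) hτ.1.eigenvalues_nonneg (diagIn_nonneg _ hσ.1)
    (by simp only [← diagIn_eigenvectorUnitary hτ.1.1, sum_diagIn, hτ.2, Complex.one_re])
    (by rw [sum_diagIn, hσ.2, Complex.one_re]) hν (by positivity)
    (by
      have h := sum_abs_diagIn_le hτ.1.1.eigenvectorUnitary hH
      simp only [diagIn_sub, diagIn_eigenvectorUnitary hτ.1.1] at h
      linarith)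
    (by
      intro i
      have h := abs_diagIn_le hτ.1.1.eigenvectorUnitary hH i
      rw [diagIn_sub, diagIn_eigenvectorUnitary hτ.1.1] at h
      exact h.trans hinf)
    (by
      have : 2 * ν * (Fintype.card n : ℝ) / (ν * (Fintype.card n : ℝ) + 3) =
        2 * (ν * (Fintype.card n : ℝ) / (ν * (Fintype.card n : ℝ) + 3)) := by ring
      linarith)
  have hlog : 0 < log 2 := log_pos one_lt_two
  have e : ν * (Fintype.card n : ℝ) / (ε / 2) = 2 * ν / ε * (Fintype.card n : ℝ) := by
    rw [div_div_eq_mul_div]; ring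
  rw [e] at key
  rw [vonNeumannEntropy_eq_sum hσ.1.1, vonNeumannEntropy_eq_sum hτ.1.1, binEntropyBits_eq,
    Real.logb, ← sub_div, mul_div_assoc', ← add_div]
  refine div_le_div_of_nonneg_right ?_ hlog.le
  linarith [sum_negMulLog_eigenvalues_le hτ.1.1.eigenvectorUnitary hσ.1]

theorem schattenOne_neg (X : Matrix n n ℂ) : schattenOne (-X) = schattenOne X := by
  simp [schattenOne]

theorem schattenInf_neg (X : Matrix n n ℂ) : schattenInf (-X) = schattenInf X := by
  simp [schattenInf]

theorem abs_vonNeumannEntropy_sub_le {σ τ : Matrix n n ℂ} (hσ : IsDensityMatrix σ)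
    (hτ : IsDensityMatrix τ) {ε ν : ℝ} (hε : 0 ≤ ε) (hν : 0 ≤ ν)
    (h1 : schattenOne (τ - σ) ≤ ε) (hinf : schattenInf (τ - σ) ≤ ν)
    (hεν : ε ≤ 2 * ν * (Fintype.card n : ℝ) / (ν * (Fintype.card n : ℝ) + 3)) :
    |vonNeumannEntropy σ - vonNeumannEntropy τ| ≤
      ε / 2 * Real.logb 2 (2 * ν / ε * (Fintype.card n : ℝ) - 1) + binEntropyBits (ε / 2) := by
  refine abs_sub_le_iff.mpr ⟨vonNeumannEntropy_sub_le hσ hτ hε hν h1 hinf hεν,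
    vonNeumannEntropy_sub_le hτ hσ hε hν ?_ ?_ hεν⟩
  · rwa [← schattenOne_neg, neg_sub]
  · rwa [← schattenInf_neg, neg_sub]

end Entropy

/-! ### Invariance of the entropy under isometries -/

section Isometry
variable {m n : Type*} [Fintype m] [DecidableEq m] [Fintype n] [DecidableEq n]

theorem trace_conjMap {m n : Type*} [Fintype m] [DecidableEq m] [Fintype n] {W : Matrix n m ℂ} (hW : W.conjTranspose * W = 1) (X : Matrix m m ℂ) :
    (conjMap W X).trace = X.trace := by
  change (W * X * W.conjTranspose).trace = _
  rw [Matrix.trace_mul_cycle, hW, one_mul]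

/-- Conjugation by an isometry, as a homomorphism of star algebras. -/
def isometryConjHom (W : Matrix n m ℂ) (hW : W.conjTranspose * W = 1) :
    Matrix m m ℂ →⋆ₙₐ[ℝ] Matrix n n ℂ where
  toFun X := conjMap W X
  map_smul' c X := by
    change W * (c • X) * W.conjTranspose = c • (W * X * W.conjTranspose)
    simp
  map_zero' := map_zero _
  map_add' := map_add _
  map_mul' X Y := by
    change W * (X * Y) * W.conjTranspose =
      W * X * W.conjTranspose * (W * Y * W.conjTranspose)
    calc W * (X * Y) * W.conjTranspose
        = W * X * (1 : Matrix m m ℂ) * Y * W.conjTranspose := by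
          simp only [Matrix.mul_one, Matrix.mul_assoc]
      _ = _ := by rw [← hW]; simp only [Matrix.mul_assoc]
  map_star' X := by
    change W * X.conjTranspose * W.conjTranspose = (W * X * W.conjTranspose).conjTranspose
    simp [Matrix.conjTranspose_mul, Matrix.mul_assoc]

theorem conjMap_isHermitian {m n : Type*} [Fintype m] (W : Matrix n m ℂ) {X : Matrix m m ℂ} (hX : X.IsHermitian) :
    (conjMap W X).IsHermitian :=
  Matrix.isHermitian_mul_mul_conjTranspose W hX

/-- Conjugation by `W` is multiplicative but not unital, so it commutes only with the functional
calculus of functions vanishing at `0`, such as `negMulLog`: the added zero eigenvalues contribute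
nothing. -/
theorem vonNeumannEntropy_conjMap {W : Matrix n m ℂ} (hW : W.conjTranspose * W = 1)
    {ρ : Matrix m m ℂ} (hρ : ρ.IsHermitian) :
    vonNeumannEntropy (conjMap W ρ) = vonNeumannEntropy ρ := by
  have hW' := conjMap_isHermitian W hρ
  have hc : Continuous (isometryConjHom W hW) := by
    change Continuous fun X : Matrix m m ℂ => W * X * W.conjTranspose
    fun_prop
  have h := (isometryConjHom W hW).map_cfcₙ negMulLog ρ continuous_negMulLog.continuousOn
    negMulLog_zero hc hρ hW'
  rw [cfcₙ_eq_cfc continuous_negMulLog.continuousOn negMulLog_zero,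
    cfcₙ_eq_cfc continuous_negMulLog.continuousOn negMulLog_zero] at h
  rw [vonNeumannEntropy_eq_trace_cfc hρ, vonNeumannEntropy_eq_trace_cfc hW', ← trace_conjMap hW]
  exact congrArg (fun X : Matrix n n ℂ => X.trace.re / log 2) h.symm

end Isometry

/-! ### From diamond and cb norms to norms of single outputs -/

section Norms
variable {m n : Type*} [Fintype m] [DecidableEq m] [Fintype n] [DecidableEq n]

open scoped Matrix.Norms.L2Operator in
theorem schattenInf_eq_norm (X : Matrix n n ℂ) : schattenInf X = ‖X‖ := rfl

theorem schattenOne_conjMap {W : Matrix n m ℂ} (hW : W.conjTranspose * W = 1)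
    (X : Matrix m m ℂ) : schattenOne (conjMap W X) = schattenOne X := by
  have hc : Continuous (isometryConjHom W hW) := by
    change Continuous fun X : Matrix m m ℂ => W * X * W.conjTranspose
    fun_prop
  have hX := Matrix.isHermitian_conjTranspose_mul_self X
  have h := (isometryConjHom W hW).map_cfcₙ Real.sqrt (X.conjTranspose * X)
    Real.continuous_sqrt.continuousOn Real.sqrt_zero hc hX.isSelfAdjoint
    (conjMap_isHermitian W hX).isSelfAdjoint
  rw [cfcₙ_eq_cfc Real.continuous_sqrt.continuousOn Real.sqrt_zero,
    cfcₙ_eq_cfc Real.continuous_sqrt.continuousOn Real.sqrt_zero] at h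
  have e : isometryConjHom W hW (X.conjTranspose * X) =
      (conjMap W X).conjTranspose * conjMap W X := by
    rw [map_mul]
    exact congrArg (· * _) (map_star (isometryConjHom W hW) X)
  rw [e] at h
  rw [schattenOne, schattenOne, ← trace_conjMap hW]
  exact congrArg (fun X : Matrix n n ℂ => X.trace.re) h.symm

open scoped Matrix.Norms.L2Operator in
theorem l2_opNorm_le_one_of_isometry {m n : Type*} [Fintype m] [DecidableEq m] [Fintype n]
    {W : Matrix n m ℂ} (hW : W.conjTranspose * W = 1) :
    ‖W‖ ≤ 1 := by
  have h := Matrix.l2_opNorm_conjTranspose_mul_self W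
  have h1 : ‖(1 : Matrix m m ℂ)‖ ≤ 1 := by
    rw [← Matrix.diagonal_one, Matrix.l2_opNorm_diagonal]
    exact (pi_norm_le_iff_of_nonneg zero_le_one).mpr fun i => by simp
  rw [hW] at h
  nlinarith [norm_nonneg W]

open scoped Matrix.Norms.L2Operator in
theorem l2_opNorm_mul_mul_le {A : Matrix n m ℂ} (Y : Matrix m m ℂ) {B : Matrix m n ℂ}
    (hA : ‖A‖ ≤ 1) (hB : ‖B‖ ≤ 1) : ‖A * Y * B‖ ≤ ‖Y‖ :=
  calc ‖A * Y * B‖ ≤ ‖A‖ * ‖Y‖ * ‖B‖ :=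
        (Matrix.l2_opNorm_mul _ _).trans
          (mul_le_mul_of_nonneg_right (Matrix.l2_opNorm_mul _ _) (norm_nonneg _))
    _ ≤ 1 * ‖Y‖ * 1 := by gcongr
    _ = ‖Y‖ := by ring

open scoped Matrix.Norms.L2Operator in
-- Conjugation by `W` and by `W†` are both contractive, and the second undoes the first.
theorem schattenInf_conjMap {W : Matrix n m ℂ} (hW : W.conjTranspose * W = 1)
    (X : Matrix m m ℂ) : schattenInf (conjMap W X) = schattenInf X := by
  have h1 := l2_opNorm_le_one_of_isometry hW
  have h1' : ‖W.conjTranspose‖ ≤ 1 := by rwa [Matrix.l2_opNorm_conjTranspose]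
  rw [schattenInf_eq_norm, schattenInf_eq_norm]
  refine le_antisymm (l2_opNorm_mul_mul_le X h1 h1') ?_
  have e : W.conjTranspose * (W * X * W.conjTranspose) * W = X := by
    calc W.conjTranspose * (W * X * W.conjTranspose) * W
        = (W.conjTranspose * W) * X * (W.conjTranspose * W) := by
          simp only [Matrix.mul_assoc]
      _ = X := by rw [hW, one_mul, mul_one]
  have h := l2_opNorm_mul_mul_le (W * X * W.conjTranspose) h1' h1
  rwa [e] at h

theorem IsDensityMatrix.sum_eigenvalues {ρ : Matrix n n ℂ} (hρ : IsDensityMatrix ρ) :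
    ∑ i, hρ.1.1.eigenvalues i = 1 := by
  simp only [← diagIn_eigenvectorUnitary hρ.1.1, sum_diagIn, hρ.2, Complex.one_re]

theorem IsDensityMatrix.eigenvalues_le_one {ρ : Matrix n n ℂ} (hρ : IsDensityMatrix ρ) (i : n) :
    hρ.1.1.eigenvalues i ≤ 1 :=
  hρ.sum_eigenvalues ▸
    Finset.single_le_sum (fun j _ => hρ.1.eigenvalues_nonneg j) (Finset.mem_univ i)

theorem IsDensityMatrix.schattenOne_eq {ρ : Matrix n n ℂ} (hρ : IsDensityMatrix ρ) :
    schattenOne ρ = 1 := by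
  rw [schattenOne_eq_sum hρ.1.1, ← hρ.sum_eigenvalues]
  exact Finset.sum_congr rfl fun i _ => abs_of_nonneg (hρ.1.eigenvalues_nonneg i)

theorem IsDensityMatrix.schattenInf_le {ρ : Matrix n n ℂ} (hρ : IsDensityMatrix ρ) :
    schattenInf ρ ≤ 1 := by
  open scoped Matrix.Norms.L2Operator in
  have h : ρ = conjMap (hρ.1.1.eigenvectorUnitary : Matrix n n ℂ)
      (Matrix.diagonal (RCLike.ofReal ∘ hρ.1.1.eigenvalues)) := hρ.1.1.spectral_theorem
  rw [h, schattenInf_conjMap (Unitary.coe_star_mul_self _), schattenInf_eq_norm,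
    Matrix.l2_opNorm_diagonal]
  refine (pi_norm_le_iff_of_nonneg zero_le_one).mpr fun i => ?_
  simpa [abs_of_nonneg (hρ.1.eigenvalues_nonneg i)] using hρ.eigenvalues_le_one i

/-- The inclusion `ℂ^m → ℂ^m ⊗ ℂ^1`. -/
def unitorMatrix (m : Type*) [DecidableEq m] : Matrix (m × Fin 1) m ℂ :=
  (1 : Matrix m m ℂ).submatrix Prod.fst id

theorem unitorMatrix_isometry : (unitorMatrix m).conjTranspose * unitorMatrix m = 1 := by
  ext i j
  simp [unitorMatrix, Matrix.mul_apply, Fintype.sum_prod_type, Matrix.one_apply]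
  split_ifs <;> simp

theorem conjMap_unitorMatrix (X : Matrix m m ℂ) :
    conjMap (unitorMatrix m) X = X.submatrix Prod.fst Prod.fst := by
  ext p q
  simp [conjMap, unitorMatrix, Matrix.mul_apply, Matrix.one_apply]

/-- Identifies `Φ ⊗ id_1` with `Φ`, so that the `k = 1` term of each supremum controls `Φ` itself.
-/
theorem ampliation_one_conjMap (Φ : Matrix m m ℂ →ₗ[ℂ] Matrix n n ℂ) (X : Matrix m m ℂ) :
    ampliation Φ 1 (conjMap (unitorMatrix m) X) = conjMap (unitorMatrix n) (Φ X) := by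
  rw [conjMap_unitorMatrix, conjMap_unitorMatrix]
  rfl

theorem schattenOne_apply_le_of_diamondNorm_le {Φ : Matrix m m ℂ →ₗ[ℂ] Matrix n n ℂ} {ε : ℝ}
    (hε : 0 ≤ ε) (h : diamondNorm Φ ≤ ENNReal.ofReal ε) {X : Matrix m m ℂ}
    (hX : schattenOne X ≤ 1) : schattenOne (Φ X) ≤ ε := by
  have h1 : ENNReal.ofReal (schattenOne (ampliation Φ 1 (conjMap (unitorMatrix m) X))) ≤
      diamondNorm Φ :=
    le_iSup_of_le 1 <| le_iSup_of_le le_rfl <| le_iSup_of_le (conjMap (unitorMatrix m) X) <|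
      le_iSup_of_le (by rwa [schattenOne_conjMap unitorMatrix_isometry]) le_rfl
  rw [ampliation_one_conjMap, schattenOne_conjMap unitorMatrix_isometry] at h1
  exact (ENNReal.ofReal_le_ofReal_iff hε).mp (h1.trans h)

theorem schattenInf_apply_le_of_cbNorm_le {Φ : Matrix m m ℂ →ₗ[ℂ] Matrix n n ℂ} {ν : ℝ}
    (hν : 0 ≤ ν) (h : cbNorm Φ ≤ ENNReal.ofReal ν) {X : Matrix m m ℂ}
    (hX : schattenInf X ≤ 1) : schattenInf (Φ X) ≤ ν := by
  have h1 : ENNReal.ofReal (schattenInf (ampliation Φ 1 (conjMap (unitorMatrix m) X))) ≤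
      cbNorm Φ :=
    le_iSup_of_le 1 <| le_iSup_of_le le_rfl <| le_iSup_of_le (conjMap (unitorMatrix m) X) <|
      le_iSup_of_le (by rwa [schattenInf_conjMap unitorMatrix_isometry]) le_rfl
  rw [ampliation_one_conjMap, schattenInf_conjMap unitorMatrix_isometry] at h1
  exact (ENNReal.ofReal_le_ofReal_iff hν).mp (h1.trans h)

end Norms

/-! ### Density matrices under channels and partial traces -/

section States

theorem partialTraceSnd_posSemidef {m n : Type*} [Fintype n] {X : Matrix (m × n) (m × n) ℂ}
    (hX : X.PosSemidef) : (partialTraceSnd m n X).PosSemidef := by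
  have h : partialTraceSnd m n X = ∑ j, X.submatrix (fun i => (i, j)) (fun i => (i, j)) := by
    ext i i'
    simp [partialTraceSnd, Matrix.sum_apply]
  rw [h]
  exact Matrix.posSemidef_sum _ fun j _ => hX.submatrix _

theorem partialTraceFst_posSemidef {m n : Type*} [Fintype m] {X : Matrix (m × n) (m × n) ℂ}
    (hX : X.PosSemidef) : (partialTraceFst m n X).PosSemidef := by
  have h : partialTraceFst m n X = ∑ i, X.submatrix (fun j => (i, j)) (fun j => (i, j)) := by
    ext i i'
    simp [partialTraceFst, Matrix.sum_apply]
  rw [h]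
  exact Matrix.posSemidef_sum _ fun j _ => hX.submatrix _

theorem IsDensityMatrix.partialTraceSnd {m n : Type*} [Fintype m] [Fintype n]
    {X : Matrix (m × n) (m × n) ℂ} (hX : IsDensityMatrix X) :
    IsDensityMatrix (partialTraceSnd m n X) := by
  refine ⟨partialTraceSnd_posSemidef hX.1, ?_⟩
  rw [← hX.2]
  simp [_root_.partialTraceSnd, Matrix.trace, Fintype.sum_prod_type]

theorem IsDensityMatrix.partialTraceFst {m n : Type*} [Fintype m] [Fintype n]
    {X : Matrix (m × n) (m × n) ℂ} (hX : IsDensityMatrix X) :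
    IsDensityMatrix (partialTraceFst m n X) := by
  refine ⟨partialTraceFst_posSemidef hX.1, ?_⟩
  rw [← hX.2]
  simp [_root_.partialTraceFst, Matrix.trace, Fintype.sum_prod_type_right]

theorem IsDensityMatrix.conjMap {m n : Type*} [Fintype m] [DecidableEq m] [Fintype n]
    {W : Matrix n m ℂ} (hW : W.conjTranspose * W = 1) {X : Matrix m m ℂ}
    (hX : IsDensityMatrix X) : IsDensityMatrix (conjMap W X) :=
  ⟨hX.1.mul_mul_conjTranspose_same W, by rw [trace_conjMap hW, hX.2]⟩

theorem IsStinespring.isDensityMatrix {m n e : Type*} [Fintype m] [DecidableEq m] [Fintype n]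
    [Fintype e] {V : Matrix (n × e) m ℂ} {Φ : Matrix m m ℂ →ₗ[ℂ] Matrix n n ℂ}
    (hV : IsStinespring V Φ) {ρ : Matrix m m ℂ} (hρ : IsDensityMatrix ρ) :
    IsDensityMatrix (Φ ρ) := by
  rw [hV.dilation]
  exact (hρ.conjMap hV.isometry).partialTraceSnd

theorem IsStinespring.isDensityMatrix_complementaryChannel {m n e : Type*} [Fintype m]
    [DecidableEq m] [Fintype n] [Fintype e] {V : Matrix (n × e) m ℂ}
    {Φ : Matrix m m ℂ →ₗ[ℂ] Matrix n n ℂ} (hV : IsStinespring V Φ) {ρ : Matrix m m ℂ}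
    (hρ : IsDensityMatrix ρ) : IsDensityMatrix (complementaryChannel V ρ) :=
  (hρ.conjMap hV.isometry).partialTraceFst

/-- `W` acts on `B` alone and so commutes with the trace over `E`. -/
theorem partialTraceSnd_outputState {a b e f : Type*} [Fintype a] [Fintype b] [Fintype e]
    [DecidableEq e] (V : Matrix (b × e) a ℂ) (W : Matrix (e × f) b ℂ) (ρ : Matrix a a ℂ) :
    partialTraceSnd (e × f) e (outputState V W ρ) =
      conjMap W (partialTraceSnd b e (conjMap V ρ)) := by
  unfold outputState
  set Y := conjMap V ρ
  ext x y
  simp only [partialTraceSnd, conjMap, LinearMap.coe_mk, AddHom.coe_mk, Matrix.of_apply,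
    Matrix.mul_apply, Matrix.conjTranspose_apply, Matrix.kroneckerMap_apply, Matrix.one_apply,
    Fintype.sum_prod_type, mul_ite, mul_one, mul_zero, ite_mul, zero_mul, Finset.sum_ite_eq,
    Finset.mem_univ, if_true, apply_ite star, star_zero, Finset.mul_sum, Finset.sum_mul]
  rw [Finset.sum_comm]
  refine Finset.sum_congr rfl fun i _ => ?_
  rw [Finset.sum_comm]

/-! ### Compactness of the state space and attainment of the maxima -/

theorem exists_isDensityMatrix (n : Type*) [Fintype n] [DecidableEq n] [Nonempty n] :
    ∃ ρ : Matrix n n ℂ, IsDensityMatrix ρ := by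
  obtain ⟨i⟩ := ‹Nonempty n›
  refine ⟨Matrix.diagonal (Pi.single i 1), Matrix.PosSemidef.diagonal ?_, by simp⟩
  exact Pi.single_nonneg.mpr zero_le_one

variable {n : Type*} [Fintype n] [DecidableEq n]

theorem isClosed_setOf_isDensityMatrix {n : Type*} [Fintype n] :
    IsClosed {ρ : Matrix n n ℂ | IsDensityMatrix ρ} := by
  have h : {ρ : Matrix n n ℂ | IsDensityMatrix ρ} =
      ({ρ | ρ.conjTranspose = ρ} ∩ ⋂ x : n → ℂ, {ρ | 0 ≤ star x ⬝ᵥ ρ.mulVec x}) ∩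
        {ρ | ρ.trace = 1} := by
    ext ρ
    simp [IsDensityMatrix, Matrix.posSemidef_iff_dotProduct_mulVec, Matrix.IsHermitian]
  rw [h]
  refine ((isClosed_eq (by fun_prop) (by fun_prop)).inter (isClosed_iInter fun x => ?_)).inter
    (isClosed_eq (by fun_prop) (by fun_prop))
  exact isClosed_le (by fun_prop) (by fun_prop)

theorem isCompact_setOf_isDensityMatrix : IsCompact {ρ : Matrix n n ℂ | IsDensityMatrix ρ} := by
  open scoped Matrix.Norms.L2Operator in
  have : ProperSpace (Matrix n n ℂ) := FiniteDimensional.proper ℂ _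
  exact (isCompact_closedBall (0 : Matrix n n ℂ) 1).of_isClosed_subset
    isClosed_setOf_isDensityMatrix fun ρ hρ => by
      rw [mem_closedBall_zero_iff, ← schattenInf_eq_norm]
      exact IsDensityMatrix.schattenInf_le hρ

/-- Spectra of states lie in the fixed compact set `[0, 1]`, on which the functional calculus of a
continuous function depends continuously on the matrix. -/
theorem continuousOn_vonNeumannEntropy :
    ContinuousOn (vonNeumannEntropy : Matrix n n ℂ → ℝ) {ρ | IsDensityMatrix ρ} := by
  open scoped Matrix.Norms.L2Operator in
  have h : ContinuousOn (cfc negMulLog) {ρ : Matrix n n ℂ | IsDensityMatrix ρ} := by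
    refine (continuousOn_cfc (p := IsSelfAdjoint) (Matrix n n ℂ) (isCompact_Icc (a := (0 : ℝ))
      (b := 1)) negMulLog continuous_negMulLog.continuousOn).mono fun ρ hρ => ⟨hρ.1.1, ?_⟩
    rw [hρ.1.1.spectrum_real_eq_range_eigenvalues]
    rintro _ ⟨i, rfl⟩
    exact ⟨hρ.1.eigenvalues_nonneg i, IsDensityMatrix.eigenvalues_le_one hρ i⟩
  have h2 : ContinuousOn (fun ρ : Matrix n n ℂ => (cfc negMulLog ρ).trace.re / log 2)
      {ρ | IsDensityMatrix ρ} := by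
    have hc : Continuous fun X : Matrix n n ℂ => X.trace.re / log 2 := by fun_prop
    exact hc.comp_continuousOn h
  exact h2.congr fun ρ hρ => vonNeumannEntropy_eq_trace_cfc hρ.1.1

/-- The difference of the output entropies of two maps preserving density matrices attains its
maximum. -/
theorem isGreatest_entropy_sub {b e : Type*} [Nonempty n] [Fintype b] [DecidableEq b] [Fintype e]
    [DecidableEq e] {Φ : Matrix n n ℂ →ₗ[ℂ] Matrix b b ℂ} {Ψ : Matrix n n ℂ →ₗ[ℂ] Matrix e e ℂ}
    (hΦ : ∀ ρ, IsDensityMatrix ρ → IsDensityMatrix (Φ ρ))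
    (hΨ : ∀ ρ, IsDensityMatrix ρ → IsDensityMatrix (Ψ ρ)) :
    IsGreatest (coherentInfoValues Φ Ψ) (sSup (coherentInfoValues Φ Ψ)) := by
  have h : coherentInfoValues Φ Ψ =
      (fun ρ => vonNeumannEntropy (Φ ρ) - vonNeumannEntropy (Ψ ρ)) '' {ρ | IsDensityMatrix ρ} := by
    ext x
    simp [coherentInfoValues, eq_comm]
  rw [h]
  have cΦ : Continuous Φ := Φ.continuous_of_finiteDimensional
  have cΨ : Continuous Ψ := Ψ.continuous_of_finiteDimensional
  exact (isCompact_setOf_isDensityMatrix.image_of_continuousOn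
    ((continuousOn_vonNeumannEntropy.comp cΦ.continuousOn hΦ).sub
      (continuousOn_vonNeumannEntropy.comp cΨ.continuousOn hΨ))).isGreatest_sSup
    (Set.Nonempty.image _ (exists_isDensityMatrix n))

end States

end EntropyContinuity

/-! ### Comparison of the two maxima -/

theorem mainTheorem3 {A B E F : Type*} [Fintype A] [DecidableEq A] [Nonempty A]
    [Fintype B] [DecidableEq B] [Fintype E] [DecidableEq E] [Fintype F] [DecidableEq F]
    (Φ : Matrix A A ℂ →ₗ[ℂ] Matrix B B ℂ) (hΦ : IsQuantumChannel Φ)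
    (V : Matrix (B × E) A ℂ) (hV : IsStinespring V Φ)
    (ε ν : ℝ) (Λ : Matrix B B ℂ →ₗ[ℂ] Matrix E E ℂ)
    (hΛ : IsDegradingChannel Φ (complementaryChannel V) ε ν Λ)
    (W : Matrix (E × F) B ℂ) (hW : IsStinespring W Λ)
    (hε : ε ≤ 2 * ν * (Fintype.card E : ℝ) / (ν * (Fintype.card E : ℝ) + 3)) :
    IsGreatest (coherentInfoValues Φ (complementaryChannel V))
        (coherentInfo Φ (complementaryChannel V)) ∧
      IsGreatest (degradingEntropyValues V W) (degradingEntropy V W) ∧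
      |coherentInfo Φ (complementaryChannel V) - degradingEntropy V W| ≤
        ε / 2 * Real.logb 2 (2 * ν / ε * (Fintype.card E : ℝ) - 1) + binEntropyBits (ε / 2) := by
  -- `S(Φ, Λ)` becomes the coherent information with `Φᶜ` replaced by `Λ ∘ Φ`.
  have hD : degradingEntropyValues V W = coherentInfoValues Φ (Λ ∘ₗ Φ) := by
    ext x
    refine exists_congr fun ρ => and_congr_right fun hρ => ?_
    have e : condEntropySndFst (partialTraceSnd (E × F) E (outputState V W ρ)) =
        vonNeumannEntropy (Φ ρ) - vonNeumannEntropy (Λ (Φ ρ)) := by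
      rw [condEntropySndFst, partialTraceSnd_outputState, ← hV.dilation, ← hW.dilation,
        vonNeumannEntropy_conjMap hW.isometry (hV.isDensityMatrix hρ).1.1]
    rw [e]
    rfl
  have g1 : IsGreatest (coherentInfoValues Φ (complementaryChannel V))
      (coherentInfo Φ (complementaryChannel V)) :=
    isGreatest_entropy_sub (fun _ => hV.isDensityMatrix)
      fun _ => hV.isDensityMatrix_complementaryChannel
  have g2 : IsGreatest (coherentInfoValues Φ (Λ ∘ₗ Φ)) (sSup (coherentInfoValues Φ (Λ ∘ₗ Φ))) :=
    isGreatest_entropy_sub (fun _ => hV.isDensityMatrix)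
      fun _ hρ => hW.isDensityMatrix (hV.isDensityMatrix hρ)
  have bound : ∀ ρ, IsDensityMatrix ρ →
      |vonNeumannEntropy (Λ (Φ ρ)) - vonNeumannEntropy (complementaryChannel V ρ)| ≤
        ε / 2 * Real.logb 2 (2 * ν / ε * (Fintype.card E : ℝ) - 1) + binEntropyBits (ε / 2) :=
    fun ρ hρ => abs_vonNeumannEntropy_sub_le (hW.isDensityMatrix (hV.isDensityMatrix hρ))
      (hV.isDensityMatrix_complementaryChannel hρ) hΛ.eps_nonneg hΛ.nu_nonneg
      (schattenOne_apply_le_of_diamondNorm_le hΛ.eps_nonneg hΛ.diamond_le hρ.schattenOne_eq.le)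
      (schattenInf_apply_le_of_cbNorm_le hΛ.nu_nonneg hΛ.cb_le hρ.schattenInf_le) hε
  rw [degradingEntropy, hD]
  refine ⟨g1, g2, abs_sub_le_iff.mpr ⟨?_, ?_⟩⟩
  -- A maximiser of either quantity is a competitor for the other, so the pointwise bound passes to
  -- the maxima.
  · obtain ⟨ρ, hρ, h⟩ := g1.1
    have h2 := g2.2 ⟨ρ, hρ, rfl⟩
    have h3 := (abs_le.mp (bound ρ hρ)).2
    simp only [LinearMap.comp_apply] at h2
    linarith
  · obtain ⟨ρ, hρ, h⟩ := g2.1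
    have h2 := g1.2 ⟨ρ, hρ, rfl⟩
    have h3 := (abs_le.mp (bound ρ hρ)).1
    simp only [LinearMap.comp_apply] at h
    linarith
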